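/- Let $T$ be the uniform binary AND-OR tree of height $h\ge 2$: every internal node has exactly two children, all leaves are at distance $h$ from the root, the root is an AND-gate, and AND-layers and OR-layers alternate. Truth assignments are maps from the set of leaves to $\{0,1\}$; a distribution is a probability distribution on the truth assignments, and an independent distribution (ID) is one under which the values of the leaves are independent (not necessarily identically distributed). The probability of the root is the probability that the root has the value $0$. A deterministic alpha-beta pruning algorithm determines the value of the root by probing leaves one after another, where the choice of the next leaf may depend on the values found so far. It never probes a leaf again, and it never probes a leaf that has been cut off, that is, a leaf below (or equal to) a node whose value is already known; an AND-gate (OR-gate) is known to have the value $0$ ($1$) as soon as one child is known to have this value. Its cost $C(A,d)$ is the expected number of probed leaves when the truth assignment is drawn from $d$. Let $0\le r\le 1$. Then the following minima and maxima exist, and $$\max_{d\,:\,\mathrm{ID},\,r}\ \min_{A}\ C(A,d)\;<\;\max_{d\,:\,r}\ \min_{A}\ C(A,d),$$ where $A$ runs over all deterministic alpha-beta pruning algorithms on $T$, and $d$ runs over all IDs for which the probability of the root is $r$ on the left-hand side, and over all distributions for which the probability of the root is $r$ on the right-hand side. The same holds if $A$ runs, on both sides, only over the depth-first algorithms among these (those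 which, once they have probed a leaf below a node, probe no leaf elsewhere until the value of that node is known). -/

import Mathlib

namespace AndOrTree

/-- The two kinds of gates. -/
inductive Gate
  | and
  | or

/-- The other kind of gate (the layers of the tree alternate). -/
def Gate.swap : Gate → Gate
  | .and => .or
  | .or => .and

/-- The leaves of the uniform binary tree of height `h`: a leaf is the sequence of the turns
(`false` = left, `true` = right) on the path from the root to it. -/
abbrev Leaf (h : ℕ) : Type := Fin h → Bool

/-- The truth assignments (`false` = value 0, `true` = value 1). -/
abbrev Assignment (h : ℕ) : Type := Leaf h → Bool

/-- What has been found out about the leaves: `κ l = some b` if the leaf `l` has been probed and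
has the value `b`, and `κ l = none` if it has not been probed. -/
abbrev Knowledge (h : ℕ) : Type := Leaf h → Option Bool

/-- Restriction of a labelling of the leaves to the left (`b = false`) or the right (`b = true`)
sub-tree of the root. -/
def sub {h : ℕ} {α : Type} (f : Leaf (h + 1) → α) (b : Bool) : Leaf h → α :=
  fun l => f (Fin.cons b l)

/-- The value of a gate as a function of the values of its two children. -/
def Gate.value : Gate → Bool → Bool → Bool
  | .and, x, y => x && y
  | .or, x, y => x || y

/-- What is known about a gate when this much is known about its two children: one child of
value 0 (of value 1) settles an AND-gate (an OR-gate). -/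
def Gate.known : Gate → Option Bool → Option Bool → Option Bool
  | .and, some false, _ => some false
  | .and, _, some false => some false
  | .and, some true, some true => some true
  | .or, some true, _ => some true
  | .or, _, some true => some true
  | .or, some false, some false => some false
  | _, _, _ => none

/-- The value of the root of the tree of height `h` whose root is a gate of kind `g` (and in which
the kinds of gates alternate from layer to layer) under a truth assignment. -/
def rootValue : Gate → (h : ℕ) → Assignment h → Bool
  | _, 0, ω => ω Fin.elim0
  | g, h + 1, ω =>
      g.value (rootValue g.swap h (sub ω false)) (rootValue g.swap h (sub ω true))

/-- The value of the root as far as it is known (`none`: not yet known). -/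
def knownRoot : Gate → (h : ℕ) → Knowledge h → Option Bool
  | _, 0, κ => κ Fin.elim0
  | g, h + 1, κ =>
      g.known (knownRoot g.swap h (sub κ false)) (knownRoot g.swap h (sub κ true))

/-- The leaf `l` has not been cut off: neither its own value nor the value of any node on the
path from the root to it is known. -/
def Live : Gate → (h : ℕ) → Knowledge h → Leaf h → Prop
  | g, 0, κ, _ => knownRoot g 0 κ = none
  | g, h + 1, κ, l =>
      knownRoot g (h + 1) κ = none ∧ Live g.swap h (sub κ (l 0)) (Fin.tail l)

/-- Probing `l` next respects the depth-first order: at no node on the path from the root to `l`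
does it leave a child whose evaluation has begun but has not been completed. -/
def InDepthFirstOrder : Gate → (h : ℕ) → Knowledge h → Leaf h → Prop
  | _, 0, _, _ => True
  | g, h + 1, κ, l =>
      ((∀ l' : Leaf h, sub κ (!(l 0)) l' = none) ∨
        knownRoot g.swap h (sub κ (!(l 0))) ≠ none) ∧
      InDepthFirstOrder g.swap h (sub κ (l 0)) (Fin.tail l)

/-- Deterministic query strategies: halt, or probe a leaf and go on in a way that may depend on the
value found. -/
inductive Algorithm (h : ℕ)
  | halt : Algorithm h
  | probe (l : Leaf h) (next : Bool → Algorithm h) : Algorithm h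

/-- The number of leaves probed under the truth assignment `ω`. -/
def Algorithm.probes {h : ℕ} (ω : Assignment h) : Algorithm h → ℕ
  | .halt => 0
  | .probe l next => 1 + (next (ω l)).probes ω

/-- Started with the knowledge `κ`, the strategy finds the value of the root and never probes a
leaf that has been cut off (or has been probed before). -/
def Algorithm.IsAlphaBetaFrom {h : ℕ} (g : Gate) : Knowledge h → Algorithm h → Prop
  | κ, .halt => knownRoot g h κ ≠ none
  | κ, .probe l next =>
      Live g h κ l ∧ ∀ b, (next b).IsAlphaBetaFrom g (Function.update κ l (some b))

/-- Started with the knowledge `κ`, the strategy always probes leaves in a depth-first order. -/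
def Algorithm.IsDepthFirstFrom {h : ℕ} (g : Gate) : Knowledge h → Algorithm h → Prop
  | _, .halt => True
  | κ, .probe l next =>
      InDepthFirstOrder g h κ l ∧ ∀ b, (next b).IsDepthFirstFrom g (Function.update κ l (some b))

/-- The deterministic alpha-beta pruning algorithms, directional or not. -/
def alphaBeta (g : Gate) (h : ℕ) : Set (Algorithm h) :=
  {A | A.IsAlphaBetaFrom g (fun _ => none)}

/-- The deterministic alpha-beta pruning algorithms that complete the evaluation of a node, once
they have begun it, before they probe leaves elsewhere. -/
def depthFirstAlphaBeta (g : Gate) (h : ℕ) : Set (Algorithm h) :=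
  {A | A.IsAlphaBetaFrom g (fun _ => none) ∧ A.IsDepthFirstFrom g (fun _ => none)}

/-- The expected cost `C(A, d)`. -/
noncomputable def cost {h : ℕ} (A : Algorithm h) (d : Assignment h → ℝ) : ℝ :=
  ∑ ω, d ω * (A.probes ω : ℝ)

/-- The probability that the root has the value 0. -/
noncomputable def rootProb (g : Gate) {h : ℕ} (d : Assignment h → ℝ) : ℝ :=
  ∑ ω, if rootValue g h ω = false then d ω else 0

/-- The probability distributions on the truth assignments whose root has probability `r` (of
having the value 0). -/
def distributions (g : Gate) (h : ℕ) (r : ℝ) : Set (Assignment h → ℝ) :=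
  {d | d ∈ stdSimplex ℝ (Assignment h) ∧ rootProb g d = r}

/-- Independent distributions: the values of the leaves are independent, and the leaf `l` has the
value 0 with probability `p l`. -/
def IsID {h : ℕ} (d : Assignment h → ℝ) : Prop :=
  ∃ p : Leaf h → ℝ, (∀ l, p l ∈ Set.Icc (0 : ℝ) 1) ∧
    ∀ ω, d ω = ∏ l, if ω l = false then p l else 1 - p l

/-- The independent distributions whose root has probability `r`. -/
def independentDistributions (g : Gate) (h : ℕ) (r : ℝ) : Set (Assignment h → ℝ) :=
  {d | d ∈ distributions g h r ∧ IsID d}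

/-- `e` is the maximum over `d ∈ B` of the minimum over `A ∈ 𝒜` of `C(A, d)`; all these minima and
the maximum are attained. -/
def IsEquilibriumValue {h : ℕ} (𝒜 : Set (Algorithm h)) (B : Set (Assignment h → ℝ))
    (e : ℝ) : Prop :=
  (∀ d ∈ B, ∃ m, IsLeast ((fun A => cost A d) '' 𝒜) m) ∧
    IsGreatest {m | ∃ d ∈ B, IsLeast ((fun A => cost A d) '' 𝒜) m} e

end AndOrTree

/-!
An assignment is *reluctant* if at every gate that has its absorbing value (`0` for AND, `1`
for OR) exactly one of the two children has this value. A depth-first algorithm that evaluates a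
random child first needs `reluctantCost g h b` probes on average on a reluctant assignment of root
value `b`, and at most as many on every other assignment of this root value. Both maxima are
compared with `mixedCost g h r`, the average of these two numbers with the weights `r` and
`1 - r`.

*All distributions.* Draw a random reluctant assignment of root value `0` with probability `r`,
and one of root value `1` with probability `1 - r`. Every alpha-beta algorithm `A` then costs at
least `mixedCost g h r` (`le_cost_reluctantMix`). For algorithms that are not depth-first this
rests on an argument in the style of Saks and Wigderson: `A` is turned into a randomized algorithm
on a tree with one layer less, whose leaves have costs that depend on their values. When `A`
probes the first child of a gate at the bottom, a fair coin decides whether the new algorithm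
probes the gate. If it does not, `A` is given the non-absorbing value, and the gate is probed
together with its second child. Iterated down to height `0`, this becomes a potential on the
states of knowledge, `reluctantCost * openWeight - prepaid`, that is at most `0` when the root is
known, is `reluctantCost` at the start, and drops by at most the cost of a probe with every probe
(`potential_update`).

*Independent distributions.* By independence, the cost of evaluating the children of a gate one
after the other is determined by the costs and the value probabilities of the children. By
induction the better of the two orders at every gate costs at most `mixedCost`. If it attains this
bound, then the same holds at both children, and `min_order_bound` shows that both children almost
surely have the non-absorbing value. This cannot happen at a gate and at its child at once, so
that the inequality is strict from height `2` on (`exists_depthFirst_cost_lt`). As the algorithms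
found are depth-first, both versions of the theorem follow.

*Existence.* The number of probes is bounded, so that only finitely many linear functions of the
distribution occur as costs; their minimum is continuous, and both sets of distributions are
compact. -/

namespace AndOrTree

/-! ### Gates, sub-trees and knowledge -/

/-- The value of one child that settles the gate: `0` for an AND-gate, `1` for an OR-gate. -/
def Gate.absorbing : Gate → Bool
  | .and => false
  | .or => true

theorem Gate.absorbing_swap (g : Gate) : g.swap.absorbing = !g.absorbing := by
  cases g <;> rfl

/-- The assignment `ω` agrees with everything that has been found out. -/
def Consistent {h : ℕ} (κ : Knowledge h) (ω : Assignment h) : Prop :=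
  ∀ l v, κ l = some v → ω l = v

theorem sub_tail {h : ℕ} {α : Type} (f : Leaf (h + 1) → α) (l : Leaf (h + 1)) :
    sub f (l 0) (Fin.tail l) = f l := by
  simp [sub]

theorem sub_update_same {h : ℕ} {α : Type} (f : Leaf (h + 1) → α) (l : Leaf (h + 1)) (x : α) :
    sub (Function.update f l x) (l 0) = Function.update (sub f (l 0)) (Fin.tail l) x := by
  funext l'
  by_cases hl : l' = Fin.tail l
  · subst hl; simp [sub]
  · have : (Fin.cons (l 0) l' : Leaf (h + 1)) ≠ l := by
      intro h1; apply hl; rw [← h1]; simp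
    simp [sub, Function.update_of_ne hl, Function.update_of_ne this]

theorem sub_update_other {h : ℕ} {α : Type} (f : Leaf (h + 1) → α) (l : Leaf (h + 1)) (x : α)
    {b : Bool} (hb : b ≠ l 0) : sub (Function.update f l x) b = sub f b := by
  funext l'
  have : (Fin.cons b l' : Leaf (h + 1)) ≠ l := by
    intro h1; apply hb; rw [← h1]; simp
  simp [sub, Function.update_of_ne this]

theorem Live.knownRoot_eq_none {g : Gate} {h : ℕ} {κ : Knowledge h} {l : Leaf h}
    (hl : Live g h κ l) : knownRoot g h κ = none := by
  cases h with
  | zero => exact hl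
  | succ h => exact hl.1

theorem Live.eq_none {g : Gate} {h : ℕ} {κ : Knowledge h} {l : Leaf h}
    (hl : Live g h κ l) : κ l = none := by
  induction h generalizing g with
  | zero => rw [Subsingleton.elim l Fin.elim0]; exact hl
  | succ h ih => rw [← sub_tail κ l]; exact ih hl.2

theorem Gate.known_of_absorbing_left (g : Gate) (x : Option Bool) :
    g.known (some g.absorbing) x = some g.absorbing := by
  rcases g with _ | _ <;> rcases x with _ | _ | _ <;> rfl

theorem Gate.known_of_absorbing_right (g : Gate) (x : Option Bool) :
    g.known x (some g.absorbing) = some g.absorbing := by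
  rcases g with _ | _ <;> rcases x with _ | _ | _ <;> rfl

theorem Gate.known_eq_some_iff (g : Gate) (x y : Option Bool) (v : Bool) :
    g.known x y = some v ↔
      (v = g.absorbing ∧ (x = some v ∨ y = some v)) ∨
        (v = !g.absorbing ∧ x = some v ∧ y = some v) := by
  rcases g with _ | _ <;> rcases x with _ | _ | _ <;> rcases y with _ | _ | _ <;> cases v <;>
    simp [Gate.known, Gate.absorbing]

theorem knownRoot_some {g : Gate} {h : ℕ} (ω : Assignment h) :
    knownRoot g h (fun l => some (ω l)) = some (rootValue g h ω) := by
  induction h generalizing g with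
  | zero => rfl
  | succ h ih =>
    have h1 : ∀ b, sub (fun l => some (ω l)) b = fun l => some (sub ω b l) := fun b => rfl
    simp only [knownRoot, rootValue, h1, ih]
    rcases g with _ | _ <;> rcases rootValue _ h (sub ω false) with _ | _ <;>
      rcases rootValue _ h (sub ω true) with _ | _ <;> rfl

theorem knownRoot_none {g : Gate} {h : ℕ} : knownRoot g h (fun _ => none) = none := by
  induction h generalizing g with
  | zero => rfl
  | succ h ih =>
    have h1 : ∀ b, sub (fun _ : Leaf (h + 1) => (none : Option Bool)) b = fun _ => none :=
      fun b => rfl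
    simp only [knownRoot, h1, ih]
    cases g <;> rfl

theorem rootValue_eq_of_knownRoot {g : Gate} {h : ℕ} {κ : Knowledge h} {ω : Assignment h}
    (hκ : Consistent κ ω) {v : Bool} (hv : knownRoot g h κ = some v) : rootValue g h ω = v := by
  induction h generalizing g v with
  | zero => exact hκ _ _ hv
  | succ h ih =>
    have hs : ∀ b, Consistent (sub κ b) (sub ω b) := fun b l v hl => hκ _ _ hl
    rw [knownRoot, Gate.known_eq_some_iff] at hv
    rw [rootValue]
    rcases hv with ⟨rfl, hx | hx⟩ | ⟨rfl, hx, hy⟩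
    · rw [ih (hs _) hx]; cases g <;> simp [Gate.value, Gate.absorbing]
    · rw [ih (hs _) hx]; cases g <;> simp [Gate.value, Gate.absorbing]
    · rw [ih (hs _) hx, ih (hs _) hy]; cases g <;> simp [Gate.value, Gate.absorbing]

theorem consistent_update_iff {h : ℕ} {κ : Knowledge h} {l : Leaf h} (hl : κ l = none)
    {v : Bool} {ω : Assignment h} :
    Consistent (Function.update κ l (some v)) ω ↔ ω l = v ∧ Consistent κ ω := by
  constructor
  · intro hc
    refine ⟨hc l v (by simp), fun l' v' hv' => hc l' v' ?_⟩
    rw [Function.update_of_ne, hv']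
    rintro rfl; simp [hl] at hv'
  · rintro ⟨rfl, hc⟩ l' v' hv'
    by_cases h1 : l' = l
    · subst h1; simpa using hv'
    · rw [Function.update_of_ne h1] at hv'; exact hc _ _ hv'

open Classical in
/-- The assignments that agree with `κ` are split according to the value of an unprobed leaf. -/
theorem sum_consistent_update {h : ℕ} {κ : Knowledge h} {l : Leaf h} (hl : κ l = none)
    (f : Bool → Assignment h → ℝ) :
    (∑ ω, if Consistent κ ω then f (ω l) ω else 0) =
      (∑ ω, if Consistent (Function.update κ l (some false)) ω then f false ω else 0) +
        ∑ ω, if Consistent (Function.update κ l (some true)) ω then f true ω else 0 := by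
  rw [← Finset.sum_add_distrib]
  refine Finset.sum_congr rfl fun ω _ => ?_
  simp only [consistent_update_iff hl]
  cases ω l <;> simp

theorem card_unprobed_update {h : ℕ} {κ : Knowledge h} {l : Leaf h} (hl : κ l = none) (v : Bool) :
    (Finset.univ.filter fun l' => Function.update κ l (some v) l' = none).card + 1 =
      (Finset.univ.filter fun l' => κ l' = none).card := by
  have h1 : (Finset.univ.filter fun l' => Function.update κ l (some v) l' = none) =
      (Finset.univ.filter fun l' => κ l' = none).erase l := by
    ext l'
    by_cases h2 : l' = l
    · subst h2; simp
    · simp [h2]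
  rw [h1, Finset.card_erase_add_one]
  simp [hl]

theorem Algorithm.IsAlphaBetaFrom.probes_le {g : Gate} {h : ℕ} {A : Algorithm h}
    {κ : Knowledge h} (hA : A.IsAlphaBetaFrom g κ) (ω : Assignment h) :
    A.probes ω ≤ (Finset.univ.filter fun l => κ l = none).card := by
  induction A generalizing κ with
  | halt => simp [Algorithm.probes]
  | probe l next ih =>
    have h1 := ih (ω l) (hA.2 (ω l))
    have h2 := card_unprobed_update hA.1.eq_none (ω l)
    simp only [Algorithm.probes]
    omega

/-! ### The potential of a state of knowledge -/

/-- The expected cost of evaluating a tree of root value `b` when at every gate a random child is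
evaluated first and every gate of absorbing value has exactly one child of that value. -/
noncomputable def reluctantCost : Gate → ℕ → Bool → ℝ
  | _, 0, _ => 1
  | g, h + 1, b =>
      if b = g.absorbing then reluctantCost g.swap h b + reluctantCost g.swap h (!b) / 2
      else 2 * reluctantCost g.swap h b

/-- The probability that the knowledge `κ` is correct under the reluctant distribution of root
value `b`: the children of a gate of non-absorbing value are independent reluctant trees of that
value, and a gate of absorbing value has one child of either value, on a random side. -/
noncomputable def weight : Gate → (h : ℕ) → Bool → Knowledge h → ℝ
  | _, 0, b, κ => if κ Fin.elim0 = some (!b) then 0 else 1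
  | g, h + 1, b, κ =>
      if b = g.absorbing then
        (weight g.swap h b (sub κ false) * weight g.swap h (!b) (sub κ true) +
          weight g.swap h (!b) (sub κ false) * weight g.swap h b (sub κ true)) / 2
      else weight g.swap h b (sub κ false) * weight g.swap h b (sub κ true)

/-- The weight of the event that the root has not been bought yet. Here a leaf is bought when it
is probed, and when the first child of a gate is bought, a fair coin decides whether the gate is
bought as well; otherwise it is bought together with the second child. At a gate of absorbing
value the coin also tells the value of the first child: the absorbing one if the gate is bought,
and the other one if it is not. At other gates both children have the non-absorbing value anyway.

This is the reluctant distribution, generated in such a way that the values seen below a gate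
depend on its own value only once it has been bought. So the open weight is the same for both
values of the root. In terms of the children, where `w` is the weight of the non-absorbing value
and `n` the open weight, it is `n * n'` for no child bought plus
`((w - n) * n' + n * (w' - n')) / 2` for one. -/
noncomputable def openWeight : Gate → (h : ℕ) → Knowledge h → ℝ
  | _, 0, κ => if κ Fin.elim0 = none then 1 else 0
  | g, h + 1, κ =>
      (weight g.swap h (!g.absorbing) (sub κ false) * openWeight g.swap h (sub κ true) +
        openWeight g.swap h (sub κ false) * weight g.swap h (!g.absorbing) (sub κ true)) / 2

/-- The expected part of the cost of the probes made so far that is charged to gates not yet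
bought, summed over all gates. The price of a gate of absorbing value includes half the cost `c`
of a child of the other value, because with probability `1/2` such a child is evaluated first.
This cost is incurred at the first child, while at this moment the gate has been bought only with
probability `1/2`, so that `c / 4` is paid in advance. -/
noncomputable def prepaid : Gate → (h : ℕ) → Bool → Knowledge h → ℝ
  | _, 0, _, _ => 0
  | g, h + 1, b, κ =>
      if b = g.absorbing then
        (prepaid g.swap h b (sub κ false) * weight g.swap h (!b) (sub κ true) +
          weight g.swap h (!b) (sub κ false) * prepaid g.swap h b (sub κ true) +
          prepaid g.swap h (!b) (sub κ false) * weight g.swap h b (sub κ true) +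
          weight g.swap h b (sub κ false) * prepaid g.swap h (!b) (sub κ true)) / 2 +
        reluctantCost g.swap h (!b) / 4 *
          ((weight g.swap h (!b) (sub κ false) - openWeight g.swap h (sub κ false)) *
              openWeight g.swap h (sub κ true) +
            openWeight g.swap h (sub κ false) *
              (weight g.swap h (!b) (sub κ true) - openWeight g.swap h (sub κ true)))
      else prepaid g.swap h b (sub κ false) * weight g.swap h b (sub κ true) +
        weight g.swap h b (sub κ false) * prepaid g.swap h b (sub κ true)

theorem reluctantCost_pos (g : Gate) (h : ℕ) (b : Bool) : 0 < reluctantCost g h b := by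
  induction h generalizing g b with
  | zero => simp [reluctantCost]
  | succ h ih =>
    have h1 := ih g.swap b
    have h2 := ih g.swap (!b)
    rw [reluctantCost]
    split_ifs <;> positivity

theorem weight_nonneg (g : Gate) (h : ℕ) (b : Bool) (κ : Knowledge h) : 0 ≤ weight g h b κ := by
  induction h generalizing g b with
  | zero => rw [weight]; split_ifs <;> norm_num
  | succ h ih =>
    have h1 := fun b b' => ih g.swap b (sub κ b')
    rw [weight]
    have h2 := mul_nonneg (h1 b false) (h1 (!b) true)
    have h3 := mul_nonneg (h1 (!b) false) (h1 b true)
    have h4 := mul_nonneg (h1 b false) (h1 b true)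
    split_ifs <;> linarith

theorem openWeight_nonneg (g : Gate) (h : ℕ) (κ : Knowledge h) : 0 ≤ openWeight g h κ := by
  induction h generalizing g with
  | zero => rw [openWeight]; split_ifs <;> norm_num
  | succ h ih =>
    rw [openWeight]
    have w := fun b => weight_nonneg g.swap h (!g.absorbing) (sub κ b)
    have := mul_nonneg (w false) (ih g.swap (sub κ true))
    have := mul_nonneg (ih g.swap (sub κ false)) (w true)
    linarith

theorem openWeight_le_weight (g : Gate) (h : ℕ) (b : Bool) (κ : Knowledge h) :
    openWeight g h κ ≤ weight g h b κ := by
  induction h generalizing g b with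
  | zero =>
    rw [openWeight, weight]
    rcases κ Fin.elim0 with _ | v
    · simp
    · split_ifs <;> simp_all
  | succ h ih =>
    have hL := fun b => ih g.swap b (sub κ false)
    have hR := fun b => ih g.swap b (sub κ true)
    have wL := fun b => weight_nonneg g.swap h b (sub κ false)
    have wR := fun b => weight_nonneg g.swap h b (sub κ true)
    rw [openWeight, weight]
    split_ifs with hb
    · subst hb
      have := mul_le_mul_of_nonneg_left (hR g.absorbing) (wL (!g.absorbing))
      have := mul_le_mul_of_nonneg_right (hL g.absorbing) (wR (!g.absorbing))
      linarith
    · have hb' : b = !g.absorbing := Bool.eq_not.2 hb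
      subst hb'
      have := mul_le_mul_of_nonneg_left (hR (!g.absorbing)) (wL (!g.absorbing))
      have := mul_le_mul_of_nonneg_right (hL (!g.absorbing)) (wR (!g.absorbing))
      linarith

theorem prepaid_nonneg (g : Gate) (h : ℕ) (b : Bool) (κ : Knowledge h) :
    0 ≤ prepaid g h b κ := by
  induction h generalizing g b with
  | zero => simp [prepaid]
  | succ h ih =>
    have e := fun b b' => ih g.swap b (sub κ b')
    have w := fun b b' => weight_nonneg g.swap h b (sub κ b')
    have n := fun b' => openWeight_nonneg g.swap h (sub κ b')
    have nw := fun b b' => sub_nonneg.2 (openWeight_le_weight g.swap h b (sub κ b'))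
    have c := reluctantCost_pos g.swap h (!b)
    rw [prepaid]
    have := mul_nonneg (e b false) (w (!b) true)
    have := mul_nonneg (w (!b) false) (e b true)
    have := mul_nonneg (e (!b) false) (w b true)
    have := mul_nonneg (w b false) (e (!b) true)
    have := mul_nonneg (e b false) (w b true)
    have := mul_nonneg (w b false) (e b true)
    have := mul_nonneg c.le
      (add_nonneg (mul_nonneg (nw (!b) false) (n true)) (mul_nonneg (n false) (nw (!b) true)))
    split_ifs <;> linarith

theorem values_of_no_knowledge (g : Gate) (h : ℕ) :
    (∀ b, weight g h b (fun _ => none) = 1) ∧ openWeight g h (fun _ => none) = 1 ∧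
      ∀ b, prepaid g h b (fun _ => none) = 0 := by
  induction h generalizing g with
  | zero => simp [weight, openWeight, prepaid]
  | succ h ih =>
    have h1 : ∀ b, sub (fun _ : Leaf (h + 1) => (none : Option Bool)) b = fun _ => none :=
      fun b => rfl
    obtain ⟨hw, hn, he⟩ := ih g.swap
    simp [weight, openWeight, prepaid, h1, hw, hn, he]

/-- Once the root is known, the other value has no weight and nothing is open any more. -/
theorem weight_eq_zero_of_knownRoot {g : Gate} {h : ℕ} {κ : Knowledge h} {v : Bool}
    (hv : knownRoot g h κ = some v) : weight g h (!v) κ = 0 ∧ openWeight g h κ = 0 := by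
  induction h generalizing g v with
  | zero =>
    rw [knownRoot] at hv
    simp [weight, openWeight, hv]
  | succ h ih =>
    rw [knownRoot, Gate.known_eq_some_iff] at hv
    rw [weight, openWeight]
    rcases hv with ⟨rfl, hx | hx⟩ | ⟨rfl, hx, hy⟩
    · simp [ih hx]
    · simp [ih hx]
    · have h1 := ih hx
      have h2 := ih hy
      simp only [Bool.not_not] at h1 h2
      simp [h1, h2]

theorem weight_update {g : Gate} {h : ℕ} {κ : Knowledge h} {l : Leaf h} (hl : κ l = none)
    (b : Bool) :
    weight g h b κ = weight g h b (Function.update κ l (some false)) +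
      weight g h b (Function.update κ l (some true)) := by
  induction h generalizing g b with
  | zero =>
    rw [Subsingleton.elim l Fin.elim0] at *
    cases b <;> simp [weight, hl]
  | succ h ih =>
    rw [← sub_tail κ l] at hl
    have h1 := fun b => ih (g := g.swap) hl b
    simp only [weight]
    cases hb : l 0
    · have hs := fun v => sub_update_same κ l v
      have ho := fun v => sub_update_other κ l v (b := true) (by simp [hb])
      simp only [hb] at hs h1
      simp only [hs, ho, h1]
      split_ifs <;> ring
    · have hs := fun v => sub_update_same κ l v
      have ho := fun v => sub_update_other κ l v (b := false) (by simp [hb])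
      simp only [hb] at hs h1
      simp only [hs, ho, h1]
      split_ifs <;> ring

theorem openWeight_update_le {g : Gate} {h : ℕ} {κ : Knowledge h} {l : Leaf h} (hl : κ l = none) :
    openWeight g h (Function.update κ l (some false)) +
      openWeight g h (Function.update κ l (some true)) ≤ openWeight g h κ := by
  induction h generalizing g with
  | zero =>
    rw [Subsingleton.elim l Fin.elim0] at *
    simp [openWeight, hl]
  | succ h ih =>
    rw [← sub_tail κ l] at hl
    have h1 := ih (g := g.swap) hl
    have h2 := weight_update (g := g.swap) hl (!g.absorbing)
    simp only [openWeight]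
    cases hb : l 0
    · have hs := fun v => sub_update_same κ l v
      have ho := fun v => sub_update_other κ l v (b := true) (by simp [hb])
      simp only [hb] at hs h1 h2
      simp only [hs, ho, h2]
      have := mul_le_mul_of_nonneg_right h1
        (weight_nonneg g.swap h (!g.absorbing) (sub κ true))
      linarith
    · have hs := fun v => sub_update_same κ l v
      have ho := fun v => sub_update_other κ l v (b := false) (by simp [hb])
      simp only [hb] at hs h1 h2
      simp only [hs, ho, h2]
      have := mul_le_mul_of_nonneg_left h1
        (weight_nonneg g.swap h (!g.absorbing) (sub κ false))
      linarith

/-- The potential `reluctantCost * openWeight - prepaid` drops by at most the weight of the state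
of knowledge when a leaf is probed: this is the amount that one probe costs. -/
theorem potential_update {g : Gate} {h : ℕ} {κ : Knowledge h} {l : Leaf h} (hl : κ l = none)
    (b : Bool) :
    reluctantCost g h b * (openWeight g h κ -
        (openWeight g h (Function.update κ l (some false)) +
          openWeight g h (Function.update κ l (some true)))) ≤
      weight g h b κ + prepaid g h b κ -
        (prepaid g h b (Function.update κ l (some false)) +
          prepaid g h b (Function.update κ l (some true))) := by
  induction h generalizing g b with
  | zero =>
    rw [Subsingleton.elim l Fin.elim0] at *
    simp [reluctantCost, openWeight, weight, prepaid, hl]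
  | succ h ih =>
    rw [← sub_tail κ l] at hl
    have h1 := ih (g := g.swap) hl b
    have h1' := ih (g := g.swap) hl (!b)
    have hw := fun b => weight_update (g := g.swap) hl b
    have hn := sub_nonneg.2 (openWeight_update_le (g := g.swap) hl)
    have c := reluctantCost_pos g.swap h (!b)
    have aux := fun b' => mul_nonneg (mul_nonneg c.le hn)
      (sub_nonneg.2 (openWeight_le_weight g.swap h b (sub κ b')))
    have wn := fun b b' => weight_nonneg g.swap h b (sub κ b')
    simp only [openWeight, weight, prepaid, reluctantCost]
    have hs := fun v => sub_update_same κ l v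
    have ho := fun b' (hb : b' ≠ l 0) v => sub_update_other κ l v hb
    cases hb : l 0
    · have ho := fun v => ho true (by simp [hb]) v
      simp only [hb] at hs h1 h1' hw hn aux
      simp only [hs, ho]
      simp only [hw] at h1 h1' ⊢
      split_ifs with hab
      · subst hab
        have k1 := mul_le_mul_of_nonneg_right h1 (wn (!g.absorbing) true)
        have k2 := mul_le_mul_of_nonneg_right h1' (wn g.absorbing true)
        have k3 := aux true
        linarith
      · have hb' : (!g.absorbing) = b := (Bool.eq_not.2 hab).symm
        rw [hb']
        have k1 := mul_le_mul_of_nonneg_right h1 (wn b true)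
        linarith
    · have ho := fun v => ho false (by simp [hb]) v
      simp only [hb] at hs h1 h1' hw hn aux
      simp only [hs, ho]
      simp only [hw] at h1 h1' ⊢
      split_ifs with hab
      · subst hab
        have k1 := mul_le_mul_of_nonneg_left h1 (wn (!g.absorbing) false)
        have k2 := mul_le_mul_of_nonneg_left h1' (wn g.absorbing false)
        have k3 := aux false
        linarith
      · have hb' : (!g.absorbing) = b := (Bool.eq_not.2 hab).symm
        rw [hb']
        have k1 := mul_le_mul_of_nonneg_left h1 (wn b false)
        linarith

/-! ### The lower bound for the reluctant distributions -/

/-- The reluctant distribution of root value `b`. -/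
noncomputable def reluctant (g : Gate) (h : ℕ) (b : Bool) (ω : Assignment h) : ℝ :=
  weight g h b (fun l => some (ω l))

open Classical in
theorem sum_reluctant_consistent {g : Gate} {h : ℕ} {b : Bool} (κ : Knowledge h) :
    (∑ ω, if Consistent κ ω then reluctant g h b ω else 0) = weight g h b κ := by
  induction hn : (Finset.univ.filter fun l => κ l = none).card generalizing κ with
  | zero =>
    simp only [Finset.card_eq_zero, Finset.filter_eq_empty_iff, Finset.mem_univ, true_imp_iff] at hn
    choose ω hω using fun l => Option.ne_none_iff_exists'.1 (@hn l)
    have hκ : κ = fun l => some (ω l) := funext hω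
    subst hκ
    rw [Finset.sum_eq_single ω]
    · exact if_pos fun l v hv => by simpa using hv
    · intro ω' _ hne
      rw [if_neg]
      intro hc
      exact hne (funext fun l => hc l _ rfl)
    · simp
  | succ n ih =>
    obtain ⟨l, hl⟩ : (Finset.univ.filter fun l => κ l = none).Nonempty := by
      rw [← Finset.card_pos]; omega
    have hl : κ l = none := by simpa using hl
    have h1 := fun v => card_unprobed_update hl v
    rw [sum_consistent_update hl (fun _ => reluctant g h b), weight_update hl, ih, ih]
    · have := h1 true; omega
    · have := h1 false; omega

open Classical in
/-- The potential is a lower bound for the expected number of probes still to be made. -/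
theorem Algorithm.IsAlphaBetaFrom.potential_le {g : Gate} {h : ℕ} {A : Algorithm h}
    {κ : Knowledge h} (hA : A.IsAlphaBetaFrom g κ) (b : Bool) :
    reluctantCost g h b * openWeight g h κ - prepaid g h b κ ≤
      ∑ ω, if Consistent κ ω then reluctant g h b ω * (A.probes ω : ℝ) else 0 := by
  induction A generalizing κ with
  | halt =>
    obtain ⟨v, hv⟩ := Option.ne_none_iff_exists'.1 hA
    rw [(weight_eq_zero_of_knownRoot hv).2]
    have := prepaid_nonneg g h b κ
    simp [Algorithm.probes, this]
  | probe l next ih =>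
    have hl := hA.1.eq_none
    have h1 := ih false (hA.2 false)
    have h2 := ih true (hA.2 true)
    have h3 := potential_update (g := g) hl b
    have h4 : (∑ ω, if Consistent κ ω then
        reluctant g h b ω * ((Algorithm.probe l next).probes ω : ℝ) else 0) =
        (∑ ω, if Consistent κ ω then reluctant g h b ω else 0) +
        ∑ ω, if Consistent κ ω then
          (fun v ω => reluctant g h b ω * ((next v).probes ω : ℝ)) (ω l) ω else 0 := by
      rw [← Finset.sum_add_distrib]
      refine Finset.sum_congr rfl fun ω _ => ?_
      simp only [Algorithm.probes]
      split_ifs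
      · push_cast; ring
      · simp
    rw [h4, sum_reluctant_consistent, sum_consistent_update hl
      (fun v ω => reluctant g h b ω * ((next v).probes ω : ℝ))]
    linarith

/-- No alpha-beta algorithm, directional or not, gains from knowing that the assignment is drawn
from the reluctant distribution of root value `b`. -/
theorem reluctantCost_le_cost {g : Gate} {h : ℕ} {A : Algorithm h} (hA : A ∈ alphaBeta g h)
    (b : Bool) : reluctantCost g h b ≤ cost A (reluctant g h b) := by
  classical
  have h1 := Algorithm.IsAlphaBetaFrom.potential_le hA b
  obtain ⟨-, hn, he⟩ := values_of_no_knowledge g h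
  rw [hn, he] at h1
  have h2 : ∀ ω : Assignment h, Consistent (fun _ => none) ω := fun ω l v hv => by simp at hv
  simpa [h2, cost] using h1

theorem reluctant_eq_zero {g : Gate} {h : ℕ} {b : Bool} {ω : Assignment h}
    (hω : rootValue g h ω ≠ b) : reluctant g h b ω = 0 := by
  have h1 := (weight_eq_zero_of_knownRoot (knownRoot_some (g := g) ω)).1
  rwa [show (!rootValue g h ω) = b by
    cases b <;> cases h2 : rootValue g h ω <;> simp_all] at h1

theorem sum_reluctant (g : Gate) (h : ℕ) (b : Bool) : ∑ ω, reluctant g h b ω = 1 := by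
  classical
  have h1 := sum_reluctant_consistent (g := g) (b := b) (fun _ : Leaf h => none)
  have h2 : ∀ ω : Assignment h, Consistent (fun _ => none) ω := fun ω l v hv => by simp at hv
  simpa [h2, (values_of_no_knowledge g h).1 b] using h1

/-- The mixture of the two reluctant distributions. -/
noncomputable def reluctantMix (g : Gate) (h : ℕ) (r : ℝ) (ω : Assignment h) : ℝ :=
  r * reluctant g h false ω + (1 - r) * reluctant g h true ω

theorem reluctantMix_mem (g : Gate) (h : ℕ) {r : ℝ} (hr0 : 0 ≤ r) (hr1 : r ≤ 1) :
    reluctantMix g h r ∈ distributions g h r := by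
  refine ⟨⟨fun ω => ?_, ?_⟩, ?_⟩
  · have h1 := mul_nonneg hr0 (weight_nonneg g h false (fun l => some (ω l)))
    have h2 := mul_nonneg (sub_nonneg.2 hr1) (weight_nonneg g h true (fun l => some (ω l)))
    exact add_nonneg h1 h2
  · simp only [reluctantMix, Finset.sum_add_distrib, ← Finset.mul_sum, sum_reluctant]
    ring
  · rw [rootProb]
    trans ∑ ω, r * reluctant g h false ω
    · refine Finset.sum_congr rfl fun ω _ => ?_
      split_ifs with h1
      · rw [reluctantMix, reluctant_eq_zero (b := true) (by simp [h1])]; ring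
      · rw [reluctant_eq_zero h1]; ring
    · rw [← Finset.mul_sum, sum_reluctant, mul_one]

theorem le_cost_reluctantMix {g : Gate} {h : ℕ} {A : Algorithm h} (hA : A ∈ alphaBeta g h)
    {r : ℝ} (hr0 : 0 ≤ r) (hr1 : r ≤ 1) :
    r * reluctantCost g h false + (1 - r) * reluctantCost g h true ≤
      cost A (reluctantMix g h r) := by
  have h1 := mul_le_mul_of_nonneg_left (reluctantCost_le_cost hA false) hr0
  have h2 := mul_le_mul_of_nonneg_left (reluctantCost_le_cost hA true) (sub_nonneg.2 hr1)
  refine (add_le_add h1 h2).trans_eq ?_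
  simp only [cost, reluctantMix, Finset.mul_sum, ← Finset.sum_add_distrib]
  exact Finset.sum_congr rfl fun ω _ => by ring

/-! ### Depth-first evaluation, one sub-tree after the other -/

/-- From the knowledge `κ` on, the strategy is a depth-first alpha-beta pruning algorithm. -/
def Algorithm.IsDepthFirstAlphaBetaFrom {h : ℕ} (g : Gate) (κ : Knowledge h) (A : Algorithm h) :
    Prop :=
  A.IsAlphaBetaFrom g κ ∧ A.IsDepthFirstFrom g κ

/-- The strategy `A` for the sub-tree `b`, started with the knowledge `κ` about this sub-tree, and
followed by the strategy `k κ'`, where `κ'` is the knowledge with which `A` ends. -/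
def Algorithm.onSubtree {h : ℕ} (b : Bool) (k : Knowledge h → Algorithm (h + 1)) :
    Knowledge h → Algorithm h → Algorithm (h + 1)
  | κ, .halt => k κ
  | κ, .probe l next =>
      .probe (Fin.cons b l) fun v => onSubtree b k (Function.update κ l (some v)) (next v)

/-- What `A`, started with the knowledge `κ`, knows at the end under the assignment `ω`. -/
def Algorithm.finalKnowledge {h : ℕ} (ω : Assignment h) : Knowledge h → Algorithm h → Knowledge h
  | κ, .halt => κ
  | κ, .probe l next => finalKnowledge ω (Function.update κ l (some (ω l))) (next (ω l))

theorem Algorithm.probes_onSubtree {h : ℕ} (b : Bool) (k : Knowledge h → Algorithm (h + 1))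
    (κ : Knowledge h) (A : Algorithm h) (ω : Assignment (h + 1)) :
    (A.onSubtree b k κ).probes ω =
      A.probes (sub ω b) + (k (A.finalKnowledge (sub ω b) κ)).probes ω := by
  induction A generalizing κ with
  | halt => simp [onSubtree, finalKnowledge, probes]
  | probe l next ih => simp only [onSubtree, finalKnowledge, probes, ih]; simp only [sub]; ring

theorem Algorithm.IsAlphaBetaFrom.knownRoot_finalKnowledge {g : Gate} {h : ℕ} {A : Algorithm h}
    {κ : Knowledge h} (hA : A.IsAlphaBetaFrom g κ) {ω : Assignment h} (hω : Consistent κ ω) :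
    knownRoot g h (A.finalKnowledge ω κ) = some (rootValue g h ω) := by
  induction A generalizing κ with
  | halt =>
    obtain ⟨v, hv⟩ := Option.ne_none_iff_exists'.1 hA
    rw [finalKnowledge, rootValue_eq_of_knownRoot hω hv, hv]
  | probe l next ih =>
    exact ih _ (hA.2 _) ((consistent_update_iff hA.1.eq_none).2 ⟨rfl, hω⟩)

theorem knownRoot_succ_eq_none {g : Gate} {h : ℕ} {K : Knowledge (h + 1)} {b : Bool}
    (hb : knownRoot g.swap h (sub K b) = none)
    (ho : knownRoot g.swap h (sub K !b) ≠ some g.absorbing) :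
    knownRoot g (h + 1) K = none := by
  rw [Option.eq_none_iff_forall_ne_some]
  intro v hv
  rw [knownRoot, Gate.known_eq_some_iff] at hv
  cases b <;> rcases hv with ⟨rfl, hx | hx⟩ | ⟨rfl, hx, hy⟩ <;> simp_all

/-- A depth-first alpha-beta algorithm for one child remains one in the whole tree, if the other
child is untouched or is known to have the non-absorbing value. -/
theorem Algorithm.IsDepthFirstAlphaBetaFrom.onSubtree {g : Gate} {h : ℕ} {b : Bool}
    {k : Knowledge h → Algorithm (h + 1)} {A : Algorithm h} {K : Knowledge (h + 1)}
    (hA : A.IsDepthFirstAlphaBetaFrom g.swap (sub K b))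
    (ho : (∀ l, sub K (!b) l = none) ∨ knownRoot g.swap h (sub K !b) = some !g.absorbing)
    (hk : ∀ K' : Knowledge (h + 1), sub K' (!b) = sub K (!b) →
      knownRoot g.swap h (sub K' b) ≠ none → (k (sub K' b)).IsDepthFirstAlphaBetaFrom g K') :
    (A.onSubtree b k (sub K b)).IsDepthFirstAlphaBetaFrom g K := by
  induction A generalizing K with
  | halt => exact hk K rfl hA.1
  | probe l next ih =>
    have hne : (!b) ≠ (Fin.cons b l : Leaf (h + 1)) 0 := by simp
    have hs : ∀ v, sub (Function.update K (Fin.cons b l) (some v)) b =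
        Function.update (sub K b) l (some v) := fun v => by
      simpa using sub_update_same K (Fin.cons b l) (some v)
    have hso : ∀ v, sub (Function.update K (Fin.cons b l) (some v)) (!b) = sub K (!b) :=
      fun v => sub_update_other K _ _ hne
    have hn : knownRoot g.swap h (sub K !b) ≠ some g.absorbing := by
      rcases ho with ho | ho
      · rw [show sub K (!b) = fun _ => none from funext ho, knownRoot_none]; simp
      · rw [ho]; simp
    have hrec : ∀ v, ((next v).onSubtree b k
        (Function.update (sub K b) l (some v))).IsDepthFirstAlphaBetaFrom g
          (Function.update K (Fin.cons b l) (some v)) := fun v => by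
      have := ih v (K := Function.update K (Fin.cons b l) (some v))
        (by rw [hs]; exact ⟨hA.1.2 v, hA.2.2 v⟩) (by rw [hso]; exact ho)
        (by rw [hso]; exact hk)
      rwa [hs] at this
    refine ⟨⟨⟨knownRoot_succ_eq_none hA.1.1.knownRoot_eq_none hn, ?_⟩, fun v => (hrec v).1⟩,
      ⟨?_, ?_⟩, fun v => (hrec v).2⟩
    · simpa using hA.1.1
    · simp only [Fin.cons_zero]
      exact ho.imp_right fun h1 => by simp [h1]
    · simpa using hA.2.1

/-- Evaluate the sub-tree `b` by `A`, and then, unless this settles the root, the other one by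
`B`. -/
def Algorithm.evalFirst {h : ℕ} (g : Gate) (b : Bool) (A B : Algorithm h) : Algorithm (h + 1) :=
  A.onSubtree b (fun κ => if knownRoot g.swap h κ = some g.absorbing then .halt
    else B.onSubtree (!b) (fun _ => .halt) (fun _ => none)) (fun _ => none)

theorem Algorithm.evalFirst_mem {g : Gate} {h : ℕ} (b : Bool) {A B : Algorithm h}
    (hA : A ∈ depthFirstAlphaBeta g.swap h) (hB : B ∈ depthFirstAlphaBeta g.swap h) :
    A.evalFirst g b B ∈ depthFirstAlphaBeta g (h + 1) := by
  refine IsDepthFirstAlphaBetaFrom.onSubtree (K := fun _ => none) hA (Or.inl fun _ => rfl) ?_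
  intro K hK hb
  have hK' : sub K (!b) = fun _ => none := hK
  obtain ⟨v, hv⟩ := Option.ne_none_iff_exists'.1 hb
  by_cases hva : v = g.absorbing
  · subst hva
    rw [if_pos hv]
    refine ⟨?_, trivial⟩
    show knownRoot g (h + 1) K ≠ none
    rw [knownRoot]
    cases b
    · rw [hv, Gate.known_of_absorbing_left]; simp
    · rw [hv, Gate.known_of_absorbing_right]; simp
  · have hva' : v = !g.absorbing := Bool.eq_not.2 hva
    subst hva'
    rw [if_neg (by simp [hv]), ← hK']
    refine IsDepthFirstAlphaBetaFrom.onSubtree (by rw [hK']; exact hB)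
      (Or.inr (by simpa using hv)) ?_
    intro K' h1 h2
    rw [Bool.not_not] at h1
    refine ⟨?_, trivial⟩
    obtain ⟨w, hw⟩ := Option.ne_none_iff_exists'.1 h2
    show knownRoot g (h + 1) K' ≠ none
    have h3 : knownRoot g (h + 1) K' = some w := by
      rw [knownRoot, Gate.known_eq_some_iff]
      rw [← h1] at hv
      by_cases hwa : w = g.absorbing
      · left; cases b <;> simp_all
      · right
        have hwa' : w = !g.absorbing := Bool.eq_not.2 hwa
        cases b <;> simp_all
    simp [h3]

theorem Algorithm.probes_evalFirst {g : Gate} {h : ℕ} (b : Bool) {A : Algorithm h}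
    (hA : A ∈ alphaBeta g.swap h) (B : Algorithm h) (ω : Assignment (h + 1)) :
    (A.evalFirst g b B).probes ω = A.probes (sub ω b) +
      if rootValue g.swap h (sub ω b) = !g.absorbing then B.probes (sub ω !b) else 0 := by
  rw [evalFirst, probes_onSubtree, IsAlphaBetaFrom.knownRoot_finalKnowledge hA
    (fun l v hv => by simp at hv)]
  by_cases hv : rootValue g.swap h (sub ω b) = g.absorbing
  · simp [hv, probes]
  · have hv' : rootValue g.swap h (sub ω b) = !g.absorbing :=
      Bool.eq_not.2 hv
    simp [hv', probes_onSubtree, probes]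

/-! ### Independent distributions -/

/-- An assignment of a tree is a pair of assignments of its two sub-trees. -/
def assignmentEquiv (h : ℕ) : Assignment (h + 1) ≃ Assignment h × Assignment h where
  toFun ω := (sub ω false, sub ω true)
  invFun x := fun l => (if l 0 then x.2 else x.1) (Fin.tail l)
  left_inv ω := by
    funext l
    cases hl : l 0
    · rw [← sub_tail ω l]; simp [hl]
    · rw [← sub_tail ω l]; simp [hl]
  right_inv x := by
    refine Prod.ext (funext fun l => ?_) (funext fun l => ?_) <;> simp [sub]

/-- The independent distribution under which the leaf `l` has the value `0` with probability
`p l`. -/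
def independent {h : ℕ} (p : Leaf h → ℝ) (ω : Assignment h) : ℝ :=
  ∏ l, if ω l = false then p l else 1 - p l

theorem independent_succ {h : ℕ} (p : Leaf (h + 1) → ℝ) (ω : Assignment (h + 1)) :
    independent p ω =
      independent (sub p false) (sub ω false) * independent (sub p true) (sub ω true) := by
  rw [independent, ← (Fin.consEquiv fun _ : Fin (h + 1) => Bool).prod_comp, Fintype.prod_prod_type,
    Fintype.prod_bool, mul_comm]
  rfl

/-- Expectations under an independent distribution, one sub-tree at a time. -/
theorem sum_independent_succ {h : ℕ} (p : Leaf (h + 1) → ℝ) (f : Assignment h → Assignment h → ℝ) :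
    ∑ ω, independent p ω * f (sub ω false) (sub ω true) =
      ∑ x, ∑ y, independent (sub p false) x * independent (sub p true) y * f x y := by
  rw [← Fintype.sum_prod_type', ← (assignmentEquiv h).sum_comp]
  exact Finset.sum_congr rfl fun ω _ => by rw [independent_succ]; rfl

theorem sum_independent_succ' {h : ℕ} (b : Bool) (p : Leaf (h + 1) → ℝ)
    (f : Assignment h → Assignment h → ℝ) :
    ∑ ω, independent p ω * f (sub ω b) (sub ω !b) =
      ∑ x, ∑ y, independent (sub p b) x * independent (sub p !b) y * f x y := by
  cases b
  · exact sum_independent_succ p f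
  · refine (sum_independent_succ p fun x y => f y x).trans ?_
    rw [Finset.sum_comm]
    exact Finset.sum_congr rfl fun x _ => Finset.sum_congr rfl fun y _ => by
      rw [mul_comm (independent _ y)]; rfl

theorem sum_independent {h : ℕ} (p : Leaf h → ℝ) : ∑ ω, independent p ω = 1 := by
  induction h with
  | zero =>
    rw [← (Equiv.funUnique (Leaf 0) Bool).symm.sum_comp]
    simp [independent]
  | succ h ih =>
    have h1 := sum_independent_succ p fun _ _ => 1
    simp only [mul_one, ← Finset.mul_sum, ih] at h1
    exact h1

theorem independent_nonneg {h : ℕ} {p : Leaf h → ℝ} (hp : ∀ l, p l ∈ Set.Icc (0 : ℝ) 1)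
    (ω : Assignment h) : 0 ≤ independent p ω := by
  refine Finset.prod_nonneg fun l _ => ?_
  have := hp l
  split_ifs
  · exact this.1
  · linarith [this.2]

/-- The probability that the root has the value `b`, if the leaves are independent. -/
noncomputable def valueProb (g : Gate) {h : ℕ} (p : Leaf h → ℝ) (b : Bool) : ℝ :=
  ∑ ω, independent p ω * if rootValue g h ω = b then 1 else 0

theorem valueProb_add (g : Gate) {h : ℕ} (p : Leaf h → ℝ) (b : Bool) :
    valueProb g p b + valueProb g p (!b) = 1 := by
  rw [valueProb, valueProb, ← Finset.sum_add_distrib]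
  refine Eq.trans ?_ (sum_independent p)
  refine Finset.sum_congr rfl fun ω _ => ?_
  cases b <;> cases rootValue g h ω <;> simp

theorem valueProb_nonneg (g : Gate) {h : ℕ} {p : Leaf h → ℝ} (hp : ∀ l, p l ∈ Set.Icc (0 : ℝ) 1)
    (b : Bool) : 0 ≤ valueProb g p b :=
  Finset.sum_nonneg fun ω _ => mul_nonneg (independent_nonneg hp ω) (by split_ifs <;> norm_num)

theorem rootProb_independent (g : Gate) {h : ℕ} (p : Leaf h → ℝ) :
    rootProb g (independent p) = valueProb g p false := by
  rw [rootProb, valueProb]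
  exact Finset.sum_congr rfl fun ω _ => by split_ifs <;> simp

theorem valueProb_not_absorbing_succ (g : Gate) {h : ℕ} (p : Leaf (h + 1) → ℝ) :
    valueProb g p (!g.absorbing) = valueProb g.swap (sub p false) (!g.absorbing) *
      valueProb g.swap (sub p true) (!g.absorbing) := by
  have h1 := sum_independent_succ p fun x y =>
    (if rootValue g.swap h x = !g.absorbing then 1 else 0) *
      (if rootValue g.swap h y = !g.absorbing then 1 else 0)
  rw [valueProb, valueProb, valueProb, Finset.sum_mul_sum]
  refine Eq.trans (Finset.sum_congr rfl fun ω _ => ?_)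
    (h1.trans (Finset.sum_congr rfl fun x _ => Finset.sum_congr rfl fun y _ => by ring))
  rw [rootValue]
  congr 1
  rcases g with _ | _ <;> cases rootValue _ h (sub ω false) <;>
    cases rootValue _ h (sub ω true) <;> simp [Gate.value, Gate.absorbing]

theorem cost_evalFirst {g : Gate} {h : ℕ} (b : Bool) {A : Algorithm h}
    (hA : A ∈ alphaBeta g.swap h) (B : Algorithm h) (p : Leaf (h + 1) → ℝ) :
    cost (A.evalFirst g b B) (independent p) = cost A (independent (sub p b)) +
      valueProb g.swap (sub p b) (!g.absorbing) * cost B (independent (sub p !b)) := by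
  have h1 := sum_independent_succ' b p fun x y => (A.probes x : ℝ) +
    (if rootValue g.swap h x = !g.absorbing then 1 else 0) * (B.probes y : ℝ)
  have h2 : cost A (independent (sub p b)) = ∑ x, ∑ y, independent (sub p b) x *
      independent (sub p !b) y * (A.probes x : ℝ) := by
    refine Finset.sum_congr rfl fun x _ => ?_
    rw [← Finset.sum_mul, ← Finset.mul_sum, sum_independent, mul_one]
  rw [h2, cost, valueProb, cost, Finset.sum_mul_sum, ← Finset.sum_add_distrib]
  refine Eq.trans (Finset.sum_congr rfl fun ω _ => ?_)
    (h1.trans (Finset.sum_congr rfl fun x _ => ?_))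
  · rw [Algorithm.probes_evalFirst b hA]
    congr 1
    split_ifs <;> simp
  · rw [← Finset.sum_add_distrib]
    exact Finset.sum_congr rfl fun y _ => by ring

/-! ### The upper bound for independent distributions -/

/-- If neither order of evaluating the children of a gate is cheaper than the bound, then nothing
is lost against the bound at the first child and both children almost surely have the
non-absorbing value. Here `s` and `t` are the probabilities that the children have the
non-absorbing value, `x` and `y` are the costs of evaluating them, and `c` and `c'` are the costs
of a reluctant child of absorbing and of non-absorbing value. -/
theorem min_order_bound {s t x y c c' : ℝ} (hs0 : 0 ≤ s) (hs1 : s ≤ 1) (ht0 : 0 ≤ t) (ht1 : t ≤ 1)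
    (hx0 : 0 < x) (hy0 : 0 < y) (hc' : 0 < c')
    (hx : x ≤ (1 - s) * c + s * c') (hy : y ≤ (1 - t) * c + t * c')
    (hxy : (1 - s * t) * (c + c' / 2) + s * t * (2 * c') ≤ x + s * y)
    (hyx : (1 - s * t) * (c + c' / 2) + s * t * (2 * c') ≤ y + t * x) :
    x = (1 - s) * c + s * c' ∧ x + s * y = (1 - s * t) * (c + c' / 2) + s * t * (2 * c') ∧
      s = 1 ∧ t = 1 := by
  have k1 := mul_le_mul_of_nonneg_left hx ht0
  have k2 := mul_le_mul_of_nonneg_left hy hs0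
  have k3 := mul_nonneg (mul_nonneg hc'.le (sub_nonneg.2 hs1)) (sub_nonneg.2 ht1)
  -- The average of the costs of the two orders falls short of the bound by at least half of this.
  have k4 : c' * (1 - s) * (1 - t) = 0 := by nlinarith
  have e1 : x = (1 - s) * c + s * c' := by nlinarith
  have e3 : x + s * y = (1 - s * t) * (c + c' / 2) + s * t * (2 * c') := by nlinarith
  have e4 : y + t * x = (1 - s * t) * (c + c' / 2) + s * t * (2 * c') := by nlinarith
  refine ⟨e1, e3, ?_⟩
  have k5 : x * (1 - t) = y * (1 - s) := by linarith
  have k6 : (1 - s) * (1 - t) = 0 := by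
    rcases mul_eq_zero.1 k4 with k | k
    · rw [(mul_eq_zero.1 k).resolve_left hc'.ne', zero_mul]
    · rw [k, mul_zero]
  rcases mul_eq_zero.1 k6 with k | k
  · rw [k, mul_zero] at k5
    have := (mul_eq_zero.1 k5).resolve_left hx0.ne'
    constructor <;> linarith
  · rw [k, mul_zero] at k5
    have := (mul_eq_zero.1 k5.symm).resolve_left hy0.ne'
    constructor <;> linarith

/-- The average of the costs of the two reluctant distributions, weighted with the probabilities
of the values of the root. -/
noncomputable def mixedCost (g : Gate) (h : ℕ) (r : ℝ) : ℝ :=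
  r * reluctantCost g h false + (1 - r) * reluctantCost g h true

theorem mixedCost_valueProb (g : Gate) {h : ℕ} (p : Leaf h → ℝ) (b : Bool) :
    mixedCost g h (valueProb g p false) = (1 - valueProb g p b) * reluctantCost g h (!b) +
      valueProb g p b * reluctantCost g h b := by
  have h1 := valueProb_add g p false
  rw [Bool.not_false] at h1
  rw [mixedCost]
  cases b
  · simp; ring
  · rw [show valueProb g p false = 1 - valueProb g p true by linarith]; simp

/-- If the children can be evaluated within their mixed costs, then so can the gate, by the better
of the two orders. If this order attains the mixed cost, then so does the algorithm for the left
child, and both children almost surely have the non-absorbing value. -/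
theorem exists_cost_le_of_subtrees {g : Gate} {h : ℕ} {p : Leaf (h + 1) → ℝ}
    (hp : ∀ l, p l ∈ Set.Icc (0 : ℝ) 1) (A : Bool → Algorithm h)
    (hA : ∀ b, A b ∈ depthFirstAlphaBeta g.swap h)
    (hpos : ∀ b, 0 < cost (A b) (independent (sub p b)))
    (hle : ∀ b, cost (A b) (independent (sub p b)) ≤
      mixedCost g.swap h (valueProb g.swap (sub p b) false)) :
    ∃ A' ∈ depthFirstAlphaBeta g (h + 1), 0 < cost A' (independent p) ∧
      cost A' (independent p) ≤ mixedCost g (h + 1) (valueProb g p false) ∧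
      (cost A' (independent p) = mixedCost g (h + 1) (valueProb g p false) →
        cost (A false) (independent (sub p false)) =
            mixedCost g.swap h (valueProb g.swap (sub p false) false) ∧
          ∀ b, valueProb g.swap (sub p b) (!g.absorbing) = 1) := by
  have hs0 := fun b => valueProb_nonneg g.swap (p := sub p b) (fun l => hp _) (!g.absorbing)
  have hs1 : ∀ b, valueProb g.swap (sub p b) (!g.absorbing) ≤ 1 := fun b => by
    have h1 := valueProb_add g.swap (sub p b) (!g.absorbing)
    have h2 := valueProb_nonneg g.swap (p := sub p b) (fun l => hp _) (!!g.absorbing)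
    linarith
  have hcost := fun b => cost_evalFirst b (hA b).1 (A !b) p
  have hcpos : ∀ b, 0 < cost ((A b).evalFirst g b (A !b)) (independent p) := fun b => by
    rw [hcost]
    exact add_pos_of_pos_of_nonneg (hpos b) (mul_nonneg (hs0 b) (hpos !b).le)
  have hmem := fun b => Algorithm.evalFirst_mem b (hA b) (hA !b)
  by_cases h1 : ∃ b, cost ((A b).evalFirst g b (A !b)) (independent p) <
      mixedCost g (h + 1) (valueProb g p false)
  · obtain ⟨b, hb⟩ := h1
    exact ⟨_, hmem b, hcpos b, hb.le, fun h2 => absurd h2 hb.ne⟩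
  · push Not at h1
    simp only [mixedCost_valueProb _ _ (!g.absorbing), Bool.not_not] at hle h1 ⊢
    have hf := h1 false
    have ht := h1 true
    rw [hcost, valueProb_not_absorbing_succ] at hf ht
    have hne : ¬ (!g.absorbing) = g.absorbing := by cases g.absorbing <;> simp
    simp only [reluctantCost, if_neg hne, if_true] at hf ht
    obtain ⟨e1, e2, e3, e4⟩ := min_order_bound (hs0 false) (hs1 false) (hs0 true) (hs1 true)
      (hpos false) (hpos true) (reluctantCost_pos g.swap h (!g.absorbing)) (hle false) (hle true)
      hf ht
    refine ⟨_, hmem false, hcpos false, le_of_eq ?_, fun _ => ⟨e1, fun b => ?_⟩⟩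
    · rw [hcost, valueProb_not_absorbing_succ]
      simp only [reluctantCost, if_neg hne, if_true]
      exact e2
    · cases b
      · exact e3
      · exact e4

theorem exists_depthFirst_cost_le (g : Gate) {h : ℕ} {p : Leaf h → ℝ}
    (hp : ∀ l, p l ∈ Set.Icc (0 : ℝ) 1) :
    ∃ A ∈ depthFirstAlphaBeta g h, 0 < cost A (independent p) ∧
      cost A (independent p) ≤ mixedCost g h (valueProb g p false) := by
  induction h generalizing g with
  | zero =>
    refine ⟨.probe Fin.elim0 fun _ => .halt, ⟨⟨rfl, fun b => ?_⟩, trivial, fun _ => trivial⟩, ?_⟩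
    · simp [Algorithm.IsAlphaBetaFrom, knownRoot]
    · simp [cost, Algorithm.probes, sum_independent, mixedCost, reluctantCost]
  | succ h ih =>
    choose A hA hpos hle using fun b => ih g.swap (p := sub p b) fun l => hp _
    obtain ⟨A', h1, h2, h3, -⟩ := exists_cost_le_of_subtrees hp A hA hpos hle
    exact ⟨A', h1, h2, h3⟩

/-- In a tree of height at least `2` no independent distribution is as hard as the mixture of
reluctant ones. Otherwise both orders would be equally expensive at every gate, so that the
children of every gate had the non-absorbing value almost surely; but the non-absorbing value of a
child is the absorbing value of its parent. -/
theorem exists_depthFirst_cost_lt (g : Gate) {h : ℕ} {p : Leaf (h + 2) → ℝ}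
    (hp : ∀ l, p l ∈ Set.Icc (0 : ℝ) 1) :
    ∃ A ∈ depthFirstAlphaBeta g (h + 2),
      cost A (independent p) < mixedCost g (h + 2) (valueProb g p false) := by
  have hchild : ∀ b, ∃ A ∈ depthFirstAlphaBeta g.swap (h + 1),
      0 < cost A (independent (sub p b)) ∧
      cost A (independent (sub p b)) ≤
        mixedCost g.swap (h + 1) (valueProb g.swap (sub p b) false) ∧
      (cost A (independent (sub p b)) =
        mixedCost g.swap (h + 1) (valueProb g.swap (sub p b) false) →
        valueProb g.swap (sub p b) (!g.absorbing) = 0) := fun b => by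
    choose A hA hpos hle using fun b' => exists_depthFirst_cost_le g.swap.swap
      (p := sub (sub p b) b') fun l => hp _
    obtain ⟨A', h1, h2, h3, h4⟩ :=
      exists_cost_le_of_subtrees (p := sub p b) (fun l => hp _) A hA hpos hle
    refine ⟨A', h1, h2, h3, fun h5 => ?_⟩
    have h6 := valueProb_not_absorbing_succ g.swap (sub p b)
    rw [(h4 h5).2, (h4 h5).2, Gate.absorbing_swap, Bool.not_not] at h6
    have h7 := valueProb_add g.swap (sub p b) g.absorbing
    linarith
  choose A hA hpos hle hstrict using hchild
  obtain ⟨A', h1, h2, h3, h4⟩ := exists_cost_le_of_subtrees hp A hA hpos hle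
  refine ⟨A', h1, h3.lt_of_ne fun h5 => ?_⟩
  obtain ⟨h6, h7⟩ := h4 h5
  have h8 := hstrict false h6
  rw [h7] at h8
  exact one_ne_zero h8

/-! ### Existence of the minima and maxima -/

/-- Every probability of the root is that of some independent distribution: one child can be given
the non-absorbing value for certain, so that the value of the root is that of the other child. -/
theorem exists_valueProb_eq (g : Gate) (h : ℕ) {r : ℝ} (hr : r ∈ Set.Icc (0 : ℝ) 1) (b : Bool) :
    ∃ p : Leaf h → ℝ, (∀ l, p l ∈ Set.Icc (0 : ℝ) 1) ∧ valueProb g p b = r := by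
  suffices H : ∀ (g : Gate) (r : ℝ), r ∈ Set.Icc (0 : ℝ) 1 → ∃ p : Leaf h → ℝ,
      (∀ l, p l ∈ Set.Icc (0 : ℝ) 1) ∧ valueProb g p (!g.absorbing) = r by
    by_cases hb : b = !g.absorbing
    · subst hb; exact H g r hr
    · have hb' : g.absorbing = b := by cases b <;> cases h2 : g.absorbing <;> simp_all
      obtain ⟨p, hp, h1⟩ := H g (1 - r) ⟨by linarith [hr.2], by linarith [hr.1]⟩
      have h2 := valueProb_add g p b
      rw [hb'] at h1
      exact ⟨p, hp, by linarith⟩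
  clear hr r b g
  induction h with
  | zero =>
    intro g r hr
    have h1 : ∀ x : ℝ, valueProb g (fun _ : Leaf 0 => x) false = x := fun x => by
      rw [valueProb, ← (Equiv.funUnique (Leaf 0) Bool).symm.sum_comp]
      simp [independent, rootValue]
    have h2 := fun x => valueProb_add g (fun _ : Leaf 0 => x) false
    simp only [h1, Bool.not_false] at h2
    cases g
    · refine ⟨fun _ => 1 - r, fun _ => ⟨by linarith [hr.2], by linarith [hr.1]⟩, ?_⟩
      have := h2 (1 - r)
      simp only [Gate.absorbing, Bool.not_false]
      linarith
    · exact ⟨fun _ => r, fun _ => hr, h1 r⟩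
  | succ h ih =>
    intro g r hr
    have key : ∀ s ∈ Set.Icc (0 : ℝ) 1, ∃ p : Leaf h → ℝ,
        (∀ l, p l ∈ Set.Icc (0 : ℝ) 1) ∧ valueProb g.swap p (!g.absorbing) = s := fun s hs => by
      obtain ⟨p, hp, h1⟩ := ih g.swap (1 - s) ⟨by linarith [hs.2], by linarith [hs.1]⟩
      rw [Gate.absorbing_swap, Bool.not_not] at h1
      have h2 := valueProb_add g.swap p g.absorbing
      exact ⟨p, hp, by linarith⟩
    obtain ⟨p, hp, h1⟩ := key r hr
    obtain ⟨q, hq, h2⟩ := key 1 ⟨zero_le_one, le_rfl⟩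
    refine ⟨fun l => (if l 0 then q else p) (Fin.tail l), fun l => ?_, ?_⟩
    · dsimp only
      split_ifs
      · exact hq _
      · exact hp _
    · rw [valueProb_not_absorbing_succ]
      have hf : sub (fun l : Leaf (h + 1) => (if l 0 then q else p) (Fin.tail l)) false = p := by
        funext l; simp [sub]
      have ht : sub (fun l : Leaf (h + 1) => (if l 0 then q else p) (Fin.tail l)) true = q := by
        funext l; simp [sub]
      rw [hf, ht, h1, h2, mul_one]

theorem independentDistributions_nonempty (g : Gate) (h : ℕ) {r : ℝ}
    (hr : r ∈ Set.Icc (0 : ℝ) 1) : (independentDistributions g h r).Nonempty := by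
  obtain ⟨p, hp, h1⟩ := exists_valueProb_eq g h hr false
  exact ⟨independent p, ⟨⟨independent_nonneg hp, sum_independent p⟩,
    by rw [rootProb_independent, h1]⟩, p, hp, fun ω => rfl⟩

theorem isCompact_distributions (g : Gate) (h : ℕ) (r : ℝ) : IsCompact (distributions g h r) := by
  refine (isCompact_stdSimplex ℝ (Assignment h)).inter_right ?_
  have h1 : Continuous fun d : Assignment h → ℝ => rootProb g d :=
    continuous_finsetSum _ fun ω _ => by split_ifs <;> fun_prop
  exact isClosed_eq h1 continuous_const

theorem isCompact_independentDistributions (g : Gate) (h : ℕ) (r : ℝ) :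
    IsCompact (independentDistributions g h r) := by
  refine (isCompact_distributions g h r).inter_right ?_
  have h1 : Continuous (independent : (Leaf h → ℝ) → Assignment h → ℝ) :=
    continuous_pi fun ω => continuous_finsetProd _ fun l _ => by split_ifs <;> fun_prop
  have h2 : {d : Assignment h → ℝ | IsID d} =
      independent '' Set.univ.pi fun _ : Leaf h => Set.Icc (0 : ℝ) 1 := by
    ext d
    constructor
    · rintro ⟨p, hp, hd⟩
      exact ⟨p, fun l _ => hp l, funext fun ω => (hd ω).symm⟩
    · rintro ⟨p, hp, rfl⟩
      exact ⟨p, fun l => hp l trivial, fun ω => rfl⟩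
  change IsClosed {d : Assignment h → ℝ | IsID d}
  rw [h2]
  exact ((isCompact_univ_pi fun _ => isCompact_Icc).image h1).isClosed

/-- The minima and the maximum exist: on a non-empty compact set, a minimum of finitely many
linear functions attains its maximum. -/
theorem exists_isEquilibriumValue {g : Gate} {h : ℕ} {𝒜 : Set (Algorithm h)}
    (h𝒜 : 𝒜 ⊆ alphaBeta g h) (hne : 𝒜.Nonempty) {B : Set (Assignment h → ℝ)} (hB : IsCompact B)
    (hBne : B.Nonempty) : ∃ e, IsEquilibriumValue 𝒜 B e := by
  -- The costs only depend on the numbers of probes, which are bounded.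
  have hfin : ((fun (A : Algorithm h) ω => A.probes ω) '' 𝒜).Finite := by
    refine (Set.finite_Iic fun _ : Assignment h => Fintype.card (Leaf h)).subset ?_
    rintro _ ⟨A, hA, rfl⟩ ω
    exact (Algorithm.IsAlphaBetaFrom.probes_le (h𝒜 hA) ω).trans (Finset.card_le_univ _)
  obtain ⟨F, hF⟩ : ∃ F : Finset (Assignment h → ℕ),
      ∀ P, P ∈ F ↔ P ∈ (fun (A : Algorithm h) ω => A.probes ω) '' 𝒜 :=
    ⟨hfin.toFinset, fun _ => hfin.mem_toFinset⟩
  have hFne : F.Nonempty := by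
    obtain ⟨A, hA⟩ := hne
    exact ⟨_, (hF _).2 ⟨A, hA, rfl⟩⟩
  obtain ⟨m, hm⟩ : ∃ m : (Assignment h → ℝ) → ℝ,
      ∀ d, m d = F.inf' hFne fun P => ∑ ω, d ω * (P ω : ℝ) := ⟨_, fun d => rfl⟩
  have hmc : Continuous m := by
    rw [funext hm]
    refine Continuous.finset_inf'_apply hFne fun P _ => ?_
    fun_prop
  have hleast : ∀ d, IsLeast ((fun A => cost A d) '' 𝒜) (m d) := fun d => by
    rw [hm]
    constructor
    · obtain ⟨P, hP, h1⟩ := Finset.exists_mem_eq_inf' hFne fun P => ∑ ω, d ω * (P ω : ℝ)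
      obtain ⟨A, hA, hAP⟩ := (hF P).1 hP
      refine ⟨A, hA, Eq.trans ?_ h1.symm⟩
      rw [← hAP]
      rfl
    · rintro _ ⟨A, hA, rfl⟩
      have hmem : (fun ω => A.probes ω) ∈ F := (hF _).2 ⟨A, hA, rfl⟩
      exact Finset.inf'_le (fun P : Assignment h → ℕ => ∑ ω, d ω * (P ω : ℝ)) hmem
  obtain ⟨d₀, hd₀, hmax⟩ := hB.exists_isMaxOn hBne hmc.continuousOn
  refine ⟨m d₀, fun d _ => ⟨m d, hleast d⟩, ⟨d₀, hd₀, hleast d₀⟩, ?_⟩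
  rintro x ⟨d, hd, hx⟩
  rw [hx.unique (hleast d)]
  exact hmax hd

end AndOrTree

theorem theorem5 (h : ℕ) (hh : 2 ≤ h) (r : ℝ) (hr0 : 0 ≤ r) (hr1 : r ≤ 1)
    (𝒜 : Set (AndOrTree.Algorithm h))
    (h𝒜 : 𝒜 = AndOrTree.alphaBeta .and h ∨ 𝒜 = AndOrTree.depthFirstAlphaBeta .and h) :
    ∃ eID eAll : ℝ,
      AndOrTree.IsEquilibriumValue 𝒜 (AndOrTree.independentDistributions .and h r) eID ∧
      AndOrTree.IsEquilibriumValue 𝒜 (AndOrTree.distributions .and h r) eAll ∧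
      eID < eAll := by
  open AndOrTree in
  have hsub : 𝒜 ⊆ alphaBeta .and h := by
    rcases h𝒜 with rfl | rfl
    · exact subset_rfl
    · exact fun A hA => hA.1
  have hsup : depthFirstAlphaBeta .and h ⊆ 𝒜 := by
    rcases h𝒜 with rfl | rfl
    · exact fun A hA => hA.1
    · exact subset_rfl
  obtain ⟨h, rfl⟩ := Nat.exists_eq_add_of_le' hh
  have hID := independentDistributions_nonempty .and (h + 2) ⟨hr0, hr1⟩
  have hne : 𝒜.Nonempty := by
    obtain ⟨-, -, p, hp, -⟩ := hID
    obtain ⟨A, hA, -⟩ := exists_depthFirst_cost_lt .and hp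
    exact ⟨A, hsup hA⟩
  obtain ⟨eID, h1⟩ := exists_isEquilibriumValue hsub hne
    (isCompact_independentDistributions .and _ r) hID
  obtain ⟨eAll, h2⟩ := exists_isEquilibriumValue hsub hne
    (isCompact_distributions .and _ r) (hID.mono fun d hd => hd.1)
  refine ⟨eID, eAll, h1, h2, lt_of_lt_of_le (b := mixedCost .and (h + 2) r) ?_ ?_⟩
  · obtain ⟨d, ⟨hd, p, hp, hdp⟩, hleast⟩ := h1.2.1
    obtain rfl : d = independent p := funext hdp
    obtain ⟨A, hA, hlt⟩ := exists_depthFirst_cost_lt .and hp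
    rw [← rootProb_independent, hd.2] at hlt
    exact (hleast.2 ⟨A, hsup hA, rfl⟩).trans_lt hlt
  · have hmem := reluctantMix_mem .and (h + 2) hr0 hr1
    obtain ⟨m, hm⟩ := h2.1 _ hmem
    obtain ⟨A, hA, rfl⟩ := hm.1
    exact (le_cost_reluctantMix (hsub hA) hr0 hr1).trans (h2.2.2 ⟨_, hmem, hm⟩)
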